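/- Let $\mathbf{Top}$ be the category of weakly Hausdorff compactly generated spaces, with its cartesian product (the compactly generated product), and let $\mathbf{Cat}_{\mathbf{Top}}$ be the category of small categories enriched over $\mathbf{Top}$ and enriched functors. For a space $S$ let $U(S)$ be the enriched category with two objects $x$ and $y$, with $\mathbf{Map}_{U(S)}(x,y)=S$, $\mathbf{Map}_{U(S)}(y,x)=\emptyset$, and $\mathbf{Map}_{U(S)}(x,x)=\mathbf{Map}_{U(S)}(y,y)=\ast$. Let $n\ge 1$ and $0\le i\le n$, and let $f:|\Lambda^n_i|\to|\Delta^n|$ be the geometric realization of the inclusion of the $i$-th horn in the standard $n$-simplex. Let $$\begin{array}{ccc} U(|\Lambda^n_i|) & \xrightarrow{\ h\ } & \mathbf{C}\\ {\scriptstyle U(f)}\downarrow & & \downarrow{\scriptstyle F}\\ U(|\Delta^n|) & \longrightarrow & \mathbf{D}\end{array}$$ be a pushout square in $\mathbf{Cat}_{\mathbf{Top}}$, with $h$ an arbitrary enriched functor. Then $F$ is a bijection on objects, and for all objects $w,z$ of $\mathbf{C}$ the map $$\mathbf{Map}_{\mathbf{C}}(w,z)\longrightarrow\mathbf{Map}_{\mathbf{D}}(F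 w,F z)$$ given by $F$ is a topological embedding (an inclusion) and a weak homotopy equivalence. -/

import Mathlib

open CategoryTheory Limits Topology MonoidalCategory

universe u

noncomputable section

/-- A topological space is *weakly Hausdorff* if the image of every continuous map from a compact
Hausdorff space is closed. -/
class WeaklyHausdorffSpace (X : Type u) [TopologicalSpace X] : Prop where
  isClosed_range : ∀ (K : CompHaus.{u}) (f : C(K, X)), IsClosed (Set.range f)

/-- The property of being a weakly Hausdorff compactly generated space. -/
def TopCat.isCGWH : ObjectProperty TopCat.{u} :=
  fun X ↦ CompactlyGeneratedSpace X ∧ WeaklyHausdorffSpace X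

/-- The category of weakly Hausdorff compactly generated spaces and continuous maps. -/
abbrev CGWH : Type (u + 1) := TopCat.isCGWH.{u}.FullSubcategory

namespace CGWH

instance : CoeSort CGWH.{u} (Type u) := ⟨fun X ↦ X.obj⟩

instance (X : CGWH.{u}) : CompactlyGeneratedSpace X := X.property.1

instance (X : CGWH.{u}) : WeaklyHausdorffSpace X := X.property.2

/-- A weakly Hausdorff compactly generated space, as an object of `CGWH`. -/
abbrev of (X : Type u) [TopologicalSpace X] [CompactlyGeneratedSpace X]
    [WeaklyHausdorffSpace X] : CGWH.{u} where
  obj := TopCat.of X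
  property := ⟨‹_›, ‹_›⟩

/-- A continuous map, as a morphism of `CGWH`. -/
abbrev ofHom {X Y : CGWH.{u}} (f : C(X, Y)) : X ⟶ Y := ObjectProperty.homMk (TopCat.ofHom f)

/-- The continuous map underlying a morphism of `CGWH`. -/
abbrev toMap {X Y : CGWH.{u}} (f : X ⟶ Y) : C(X, Y) := f.hom.hom

end CGWH

instance WeaklyHausdorffSpace.of_t2 (X : Type u) [TopologicalSpace X]
    [T2Space X] : WeaklyHausdorffSpace X where
  isClosed_range _ f := (isCompact_range f.continuous).isClosed

/-- The family of all compact Hausdorff spaces. -/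
abbrev compHausFamily (K : CompHaus.{u}) : Type u := K

theorem isGeneratedBy_of_compactlyGeneratedSpace (X : Type u) [TopologicalSpace X]
    [CompactlyGeneratedSpace X] : IsGeneratedBy compHausFamily.{u} X where
  continuous_equiv_symm := continuous_from_uCompactlyGeneratedSpace _ fun K g ↦
    (IsGeneratedBy.equiv_symm_comp_continuous_iff _ g).2 g.continuous

instance (X : CGWH.{u}) : IsGeneratedBy compHausFamily.{u} X :=
  isGeneratedBy_of_compactlyGeneratedSpace X

theorem compactlyGeneratedSpace_of_isGeneratedBy (X : Type u) [TopologicalSpace X]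
    [IsGeneratedBy compHausFamily.{u} X] : CompactlyGeneratedSpace X :=
  uCompactlyGeneratedSpace_of_isClosed fun _ hs ↦
    (IsGeneratedBy.isClosed_iff compHausFamily.{u}).2 fun K f ↦ hs K f

instance (X : Type u) [TopologicalSpace X] :
    CompactlyGeneratedSpace (WithGeneratedByTopology compHausFamily.{u} X) :=
  compactlyGeneratedSpace_of_isGeneratedBy _

instance (X : Type u) [TopologicalSpace X] [WeaklyHausdorffSpace X] :
    WeaklyHausdorffSpace (WithGeneratedByTopology compHausFamily.{u} X) where
  isClosed_range K f := by
    have h := WeaklyHausdorffSpace.isClosed_range K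
      ((⟨_, WithGeneratedByTopology.continuous_equiv⟩ : C(_, X)).comp f)
    have h' := h.preimage (WithGeneratedByTopology.continuous_equiv (X := compHausFamily.{u}))
    convert h' using 1
    ext x
    simp

theorem WeaklyHausdorffSpace.isClosed_image {X : Type u} [TopologicalSpace X]
    [WeaklyHausdorffSpace X] (K : CompHaus.{u}) (f : C(K, X)) {s : Set K} (hs : IsClosed s) :
    IsClosed (f '' s) := by
  have : CompactSpace s := isCompact_iff_compactSpace.1 hs.isCompact
  have h := WeaklyHausdorffSpace.isClosed_range (CompHaus.of s)
    (f.comp ⟨Subtype.val, continuous_subtype_val⟩)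
  convert h using 1
  ext x
  simp

theorem WeaklyHausdorffSpace.t2_range {X : Type u} [TopologicalSpace X]
    [WeaklyHausdorffSpace X] (K : CompHaus.{u}) (f : C(K, X)) : T2Space (Set.range f) := by
  have hsing : ∀ x : X, IsClosed ({x} : Set X) := fun x ↦ by
    have h := WeaklyHausdorffSpace.isClosed_range (CompHaus.of PUnit.{u + 1})
      (ContinuousMap.const _ x)
    convert h using 1
    ext y
    simp [eq_comm]
  refine ⟨?_⟩
  rintro ⟨a, ha⟩ ⟨b, hb⟩ hab
  have hdis : Disjoint (f ⁻¹' {a}) (f ⁻¹' {b}) :=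
    Disjoint.preimage f (by simpa using fun h ↦ hab (Subtype.ext h))
  obtain ⟨U, V, hU, hV, haU, hbV, hUV⟩ := SeparatedNhds.of_isCompact_isCompact
    ((hsing a).preimage f.continuous).isCompact ((hsing b).preimage f.continuous).isCompact hdis
  refine ⟨Subtype.val ⁻¹' (f '' Uᶜ)ᶜ, Subtype.val ⁻¹' (f '' Vᶜ)ᶜ,
    (isClosed_image K f hU.isClosed_compl).isOpen_compl.preimage continuous_subtype_val,
    (isClosed_image K f hV.isClosed_compl).isOpen_compl.preimage continuous_subtype_val,
    ?_, ?_, ?_⟩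
  · rintro ⟨k, hk, rfl⟩
    exact hk (haU rfl)
  · rintro ⟨k, hk, rfl⟩
    exact hk (hbV rfl)
  · rw [Set.disjoint_left]
    rintro ⟨_, k, rfl⟩ h₁ h₂
    have hkU : k ∈ U := by_contra fun h ↦ h₁ ⟨k, h, rfl⟩
    have hkV : k ∈ V := by_contra fun h ↦ h₂ ⟨k, h, rfl⟩
    exact Set.disjoint_left.1 hUV hkU hkV

instance (X Y : Type u) [TopologicalSpace X] [TopologicalSpace Y] [WeaklyHausdorffSpace X]
    [WeaklyHausdorffSpace Y] : WeaklyHausdorffSpace (X × Y) where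
  isClosed_range K f := by
    let f₁ : C(K, X) := ContinuousMap.fst.comp f
    let f₂ : C(K, Y) := ContinuousMap.snd.comp f
    have := WeaklyHausdorffSpace.t2_range K f₁
    have := WeaklyHausdorffSpace.t2_range K f₂
    let e : Set.range f₁ × Set.range f₂ → X × Y := Prod.map Subtype.val Subtype.val
    have he : IsClosedEmbedding e :=
      (WeaklyHausdorffSpace.isClosed_range K f₁).isClosedEmbedding_subtypeVal.prodMap
        (WeaklyHausdorffSpace.isClosed_range K f₂).isClosedEmbedding_subtypeVal
    let g : K → Set.range f₁ × Set.range f₂ := fun k ↦ (⟨f₁ k, k, rfl⟩, ⟨f₂ k, k, rfl⟩)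
    have hg : Continuous g := by fun_prop
    have h := he.isClosedMap _ (isCompact_range hg).isClosed
    rw [← Set.range_comp] at h
    exact h

namespace CGWH

/-- The one-point space. -/
abbrev point : CGWH.{u} := of PUnit.{u + 1}

/-- The product of weakly Hausdorff compactly generated spaces: the set `X × Y` with the
compactly generated topology associated to the product topology. -/
abbrev prod (X Y : CGWH.{u}) : CGWH.{u} :=
  of (WithGeneratedByTopology compHausFamily.{u} (X × Y))

theorem continuous_prodMk {X : CGWH.{u}} {Y Z : Type u} [TopologicalSpace Y] [TopologicalSpace Z]
    {f : X → Y} {g : X → Z} (hf : Continuous f) (hg : Continuous g) :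
    Continuous fun x ↦ (WithGeneratedByTopology.equiv (X := compHausFamily.{u})).symm (f x, g x) :=
  (IsGeneratedBy.equiv_symm_comp_continuous_iff _ fun x ↦ (f x, g x)).2 (hf.prodMk hg)

/-- The first projection. -/
abbrev prodFst (X Y : CGWH.{u}) : prod X Y ⟶ X :=
  ofHom ⟨fun p ↦ (WithGeneratedByTopology.equiv (X := compHausFamily.{u}) p).1,
    continuous_fst.comp WithGeneratedByTopology.continuous_equiv⟩

/-- The second projection. -/
abbrev prodSnd (X Y : CGWH.{u}) : prod X Y ⟶ Y :=
  ofHom ⟨fun p ↦ (WithGeneratedByTopology.equiv (X := compHausFamily.{u}) p).2,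
    continuous_snd.comp WithGeneratedByTopology.continuous_equiv⟩

/-- The morphism to a product with given components. -/
abbrev prodLift {T X Y : CGWH.{u}} (f : T ⟶ X) (g : T ⟶ Y) : T ⟶ prod X Y :=
  ofHom ⟨_, continuous_prodMk (toMap f).continuous (toMap g).continuous⟩

/-- The one-point space is terminal. -/
def pointIsTerminal : IsTerminal point.{u} :=
  IsTerminal.ofUniqueHom (fun X ↦ ofHom (ContinuousMap.const X PUnit.unit))
    (fun _ _ ↦ rfl)

/-- The universal property of the product. -/
def prodIsLimit (X Y : CGWH.{u}) : IsLimit (BinaryFan.mk (prodFst X Y) (prodSnd X Y)) :=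
  BinaryFan.IsLimit.mk _ (fun f g ↦ prodLift f g) (fun _ _ ↦ rfl) (fun _ _ ↦ rfl)
    (fun {T} f g m h₁ h₂ ↦ by
      change T ⟶ prod X Y at m
      subst h₁ h₂
      rfl)

instance : CartesianMonoidalCategory CGWH.{u} :=
  .ofChosenFiniteProducts ⟨_, pointIsTerminal⟩ fun X Y ↦ ⟨_, prodIsLimit X Y⟩

end CGWH

section Realization

open Simplicial

namespace HornRealization

/-- Every point of the realization of a horn lies on one of its faces. -/
theorem exists_face (n : ℕ) (i : Fin (n + 2)) (p : |(Λ[n + 1, i] : SSet.{u})|) :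
    ∃ (j : Fin (n + 2)) (hj : j ≠ i) (q : |(Δ[n] : SSet.{u})|),
      SSet.toTop.map (SSet.horn.ι i j hj) q = p := by
  let A : Set |(Λ[n + 1, i] : SSet.{u})| :=
    {p | ∃ (j : Fin (n + 2)) (hj : j ≠ i) (q : |(Δ[n] : SSet.{u})|),
      SSet.toTop.map (SSet.horn.ι i j hj) q = p}
  let Z : TopCat.{u} := @TopCat.of (ULift.{u} Prop) ⊤
  let f : |(Λ[n + 1, i] : SSet.{u})| ⟶ Z :=
    @TopCat.ofHom _ _ _ ⊤ (@ContinuousMap.mk _ _ _ ⊤ (fun p ↦ ULift.up (p ∈ A)) continuous_top)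
  let g : |(Λ[n + 1, i] : SSet.{u})| ⟶ Z :=
    @TopCat.ofHom _ _ _ ⊤ (@ContinuousMap.mk _ _ _ ⊤ (fun _ ↦ ULift.up True) continuous_top)
  have hfg : f = g := by
    apply (sSetTopAdj.homEquiv _ _).injective
    apply SSet.horn.hom_ext'
    intro j hj
    rw [← Adjunction.homEquiv_naturality_left, ← Adjunction.homEquiv_naturality_left]
    congr 1
    ext q
    exact ⟨fun _ ↦ trivial, fun _ ↦ ⟨j, hj, q, rfl⟩⟩
  have h : (p ∈ A) = True := congr_arg ULift.down (ConcreteCategory.congr_hom hfg p)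
  exact of_eq_true h

theorem map_succAbove_apply {n : ℕ} (j : Fin (n + 2)) (s : stdSimplex ℝ (Fin (n + 1)))
    (l : Fin (n + 1)) : stdSimplex.map j.succAbove s (j.succAbove l) = s l := by
  simp [stdSimplex.map_coe, FunOnFinite.linearMap_apply_apply, Finset.sum_filter]

theorem map_succAbove_self {n : ℕ} (j : Fin (n + 2)) (s : stdSimplex ℝ (Fin (n + 1))) :
    stdSimplex.map j.succAbove s j = 0 := by
  simp [stdSimplex.map_coe, FunOnFinite.linearMap_apply_apply]

theorem map_succAbove_injective {n : ℕ} (j : Fin (n + 2)) :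
    Function.Injective (stdSimplex.map (S := ℝ) j.succAbove) := fun s t h ↦ by
  ext l
  rw [← map_succAbove_apply j s, h, map_succAbove_apply]

theorem exists_of_apply_eq_zero {n : ℕ} (j : Fin (n + 2)) (s : stdSimplex ℝ (Fin (n + 2)))
    (hs : s j = 0) : ∃ c, stdSimplex.map j.succAbove c = s := by
  have hsum := stdSimplex.sum_eq_one s
  rw [Fin.sum_univ_succAbove _ j, hs, zero_add] at hsum
  refine ⟨⟨fun l ↦ s (j.succAbove l), fun l ↦ stdSimplex.zero_le s _, hsum⟩, ?_⟩
  ext l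
  obtain rfl | ⟨l, rfl⟩ := Fin.eq_self_or_eq_succAbove j l
  · rw [map_succAbove_self, hs]
  · rw [map_succAbove_apply]
    rfl

theorem toTopHomeo_δ {n : ℕ} (j : Fin (n + 2)) (x : |(Δ[n] : SSet.{u})|) :
    SimplexCategory.toTopHomeo ⦋n + 1⦌ (SSet.toTop.map (SSet.stdSimplex.δ j) x) =
      stdSimplex.map j.succAbove (SimplexCategory.toTopHomeo ⦋n⦌ x) :=
  SimplexCategory.toTopHomeo_naturality_apply (SimplexCategory.δ j) x

theorem toTop_map_δ_injective {n : ℕ} (j : Fin (n + 2)) :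
    Function.Injective (SSet.toTop.map (SSet.stdSimplex.{u}.δ j)) := fun x y h ↦ by
  apply (SimplexCategory.toTopHomeo ⦋n⦌).injective
  apply map_succAbove_injective j
  rw [← toTopHomeo_δ, ← toTopHomeo_δ, h]

theorem toTop_map_δ_eq {n : ℕ} {i j k : Fin (n + 2)} (hj : j ≠ i) (hk : k ≠ i) (hjk : j < k)
    {x y : |(Δ[n] : SSet.{u})|}
    (h : SSet.toTop.map (SSet.stdSimplex.δ j) x = SSet.toTop.map (SSet.stdSimplex.δ k) y) :
    SSet.toTop.map (SSet.horn.ι i j hj) x = SSet.toTop.map (SSet.horn.ι i k hk) y := by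
  have hx : SimplexCategory.toTopHomeo ⦋n⦌ x (k.pred (Fin.ne_zero_of_lt hjk)) = 0 := by
    rw [← map_succAbove_apply j]
    rw [Fin.succAbove_pred_of_lt _ _ hjk, ← toTopHomeo_δ, h, toTopHomeo_δ, map_succAbove_self]
  obtain _ | n := n
  · have h₁ := stdSimplex.eq_one_of_unique (X := Fin 1) (SimplexCategory.toTopHomeo ⦋0⦌ x)
      (k.pred (Fin.ne_zero_of_lt hjk))
    exact absurd (hx.symm.trans h₁) zero_ne_one
  obtain ⟨c, hc⟩ := exists_of_apply_eq_zero _ _ hx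
  obtain ⟨z, rfl⟩ := (SimplexCategory.toTopHomeo ⦋n⦌).surjective c
  have hxz : SSet.toTop.map (SSet.stdSimplex.δ (k.pred (Fin.ne_zero_of_lt hjk))) z = x := by
    apply (SimplexCategory.toTopHomeo ⦋n + 1⦌).injective
    rw [← hc, toTopHomeo_δ]
  have hcomp := (SSet.horn.isCompatible_iff _).1 (SSet.horn.IsCompatible.of_hom (𝟙 (Λ[n + 2, i] : SSet.{u}))) j k hj hk hjk
  simp only [Category.comp_id] at hcomp
  have hyz : SSet.toTop.map (SSet.stdSimplex.δ (j.castPred (Fin.ne_last_of_lt hjk))) z = y := by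
    apply toTop_map_δ_injective k
    rw [← h, ← hxz]
    have h' := congr_arg (fun f ↦ SSet.toTop.map (f ≫ Λ[n + 2, i].ι) z) hcomp
    simpa using h'.symm
  subst hxz hyz
  simpa using congr_arg (fun f ↦ SSet.toTop.map f z) hcomp

/-- The realization of a horn inclusion is injective. -/
theorem toTop_map_ι_injective (n : ℕ) (i : Fin (n + 2)) :
    Function.Injective (SSet.toTop.map (Λ[n + 1, i] : (Δ[n + 1] : SSet.{u}).Subcomplex).ι) := by
  intro p q h
  obtain ⟨j, hj, x, rfl⟩ := exists_face n i p
  obtain ⟨k, hk, y, rfl⟩ := exists_face n i q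
  replace h : SSet.toTop.map (SSet.stdSimplex.δ j) x = SSet.toTop.map (SSet.stdSimplex.δ k) y := by
    have e (j : Fin (n + 2)) (hj : j ≠ i) (x : |(Δ[n] : SSet.{u})|) :
        SSet.toTop.map Λ[n + 1, i].ι (SSet.toTop.map (SSet.horn.ι i j hj) x) =
          SSet.toTop.map (SSet.stdSimplex.δ j) x := by
      rw [← SSet.horn.ι_ι i j hj, Functor.map_comp]
      rfl
    rwa [e, e] at h
  rcases lt_trichotomy j k with hjk | rfl | hjk
  · exact toTop_map_δ_eq hj hk hjk h
  · rw [toTop_map_δ_injective j h]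
  · exact (toTop_map_δ_eq hk hj hjk h.symm).symm

end HornRealization

instance (n : ℕ) : T2Space |(Δ[n] : SSet.{u})| :=
  (SimplexCategory.toTopHomeo ⦋n⦌).isEmbedding.t2Space

instance (n : ℕ) : CompactSpace |(Δ[n] : SSet.{u})| :=
  (SimplexCategory.toTopHomeo ⦋n⦌).symm.compactSpace

instance (n : ℕ) (i : Fin (n + 2)) : T2Space |(Λ[n + 1, i] : SSet.{u})| :=
  .of_injective_continuous (HornRealization.toTop_map_ι_injective n i) (SSet.toTop.map _).hom.continuous

instance (n : ℕ) (i : Fin (n + 2)) : CompactSpace |(Λ[n + 1, i] : SSet.{u})| := by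
  have h : (Set.univ : Set |(Λ[n + 1, i] : SSet.{u})|) =
      ⋃ j : {j : Fin (n + 2) // j ≠ i}, Set.range (SSet.toTop.map (SSet.horn.ι i j.1 j.2)) := by
    symm
    rw [Set.eq_univ_iff_forall]
    intro p
    obtain ⟨j, hj, x, rfl⟩ := HornRealization.exists_face n i p
    exact Set.mem_iUnion.2 ⟨⟨j, hj⟩, x, rfl⟩
  refine ⟨?_⟩
  rw [h]
  exact isCompact_iUnion fun j ↦ isCompact_range (SSet.toTop.map _).hom.continuous

/-- The realization of the standard simplex `Δ[n]`, as an object of `CGWH`. -/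
abbrev simplexSpace (n : ℕ) : CGWH.{u} := CGWH.of |(Δ[n] : SSet.{u})|

/-- The realization of the horn `Λ[n + 1, i]`, as an object of `CGWH`. -/
abbrev hornSpace (n : ℕ) (i : Fin (n + 2)) : CGWH.{u} := CGWH.of |(Λ[n + 1, i] : SSet.{u})|

/-- The realization of the inclusion of the horn `Λ[n + 1, i]` in `Δ[n + 1]`. -/
abbrev hornInclusion (n : ℕ) (i : Fin (n + 2)) : hornSpace.{u} n i ⟶ simplexSpace.{u} (n + 1) :=
  ObjectProperty.homMk (SSet.toTop.map Λ[n + 1, i].ι)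

end Realization

/-- The category of small topological categories: its objects are the small categories enriched in
weakly Hausdorff compactly generated spaces. -/
def CatTop : Type (u + 1) := EnrichedCat.{u, u + 1, u} CGWH.{u}

namespace CatTop

instance : CoeSort CatTop.{u} (Type u) := ⟨fun C ↦ Bundled.α C⟩

instance (C : CatTop.{u}) : EnrichedCategory CGWH.{u} C := Bundled.str C

/-- A topological category, as an object of `CatTop`. -/
abbrev of (C : Type u) [EnrichedCategory CGWH.{u} C] : CatTop.{u} := EnrichedCat.of CGWH.{u} C

/-- The morphisms of `CatTop` are the enriched functors. -/
instance : Category.{u} CatTop.{u} where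
  Hom C D := EnrichedFunctor CGWH.{u} C D
  id C := EnrichedFunctor.id CGWH.{u} C
  comp F G := F.comp CGWH.{u} G
  id_comp _ := EnrichedFunctor.ext _ (fun _ ↦ rfl) fun _ _ ↦
    (Category.comp_id _).trans (Category.id_comp _)
  comp_id _ := EnrichedFunctor.ext _ (fun _ ↦ rfl) fun _ _ ↦
    (Category.comp_id _).trans (Category.comp_id _)
  assoc _ _ _ := EnrichedFunctor.ext _ (fun _ ↦ rfl) fun _ _ ↦
    (Category.comp_id _).trans (Category.assoc _ _ _)

/-- The space of morphisms from `w` to `z` in a topological category. -/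
abbrev Map (C : CatTop.{u}) (w z : C) : CGWH.{u} := w ⟶[CGWH.{u}] z

/-- The action of a functor of topological categories on objects. -/
abbrev obj {C D : CatTop.{u}} (F : C ⟶ D) : C → D := EnrichedFunctor.obj F

/-- The continuous maps between spaces of morphisms given by a functor of topological
categories. -/
abbrev map {C D : CatTop.{u}} (F : C ⟶ D) (w z : C) : C(C.Map w z, D.Map (obj F w) (obj F z)) :=
  CGWH.toMap (EnrichedFunctor.map F w z)

/-- A set with two elements `x` and `y`. -/
inductive TwoObj : Type u
  | x : TwoObj
  | y : TwoObj

namespace TwoObj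

/-- The spaces of morphisms of the topological category `U S`: the space of morphisms from `x` to
`y` is `S`, there are no morphisms from `y` to `x`, and the only endomorphisms are the
identities. -/
def Hom (S : CGWH.{u}) : TwoObj.{u} → TwoObj.{u} → CGWH.{u}
  | x, x => 𝟙_ CGWH.{u}
  | x, y => S
  | y, x => CGWH.of PEmpty.{u + 1}
  | y, y => 𝟙_ CGWH.{u}

/-- The identities of `U S`. -/
def id (S : CGWH.{u}) : ∀ a : TwoObj.{u}, 𝟙_ CGWH.{u} ⟶ Hom S a a
  | x => 𝟙 _
  | y => 𝟙 _

/-- The composition of `U S`: its values are determined by the unit laws. -/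
def comp (S : CGWH.{u}) : ∀ a b c : TwoObj.{u}, Hom S a b ⊗ Hom S b c ⟶ Hom S a c
  | x, x, x => SemiCartesianMonoidalCategory.fst _ _
  | x, x, y => SemiCartesianMonoidalCategory.snd _ _
  | x, y, x => SemiCartesianMonoidalCategory.toUnit _
  | x, y, y => SemiCartesianMonoidalCategory.fst _ _
  | y, x, x => SemiCartesianMonoidalCategory.fst _ _
  | y, x, y => SemiCartesianMonoidalCategory.toUnit _
  | y, y, x => SemiCartesianMonoidalCategory.snd _ _
  | y, y, y => SemiCartesianMonoidalCategory.fst _ _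

end TwoObj

/-- The underlying set of objects of the topological category `U S`. -/
def UObj (_ : CGWH.{u}) : Type u := TwoObj.{u}

instance (S : CGWH.{u}) : EnrichedCategory CGWH.{u} (UObj S) where
  Hom := TwoObj.Hom S
  id := TwoObj.id S
  comp := TwoObj.comp S
  id_comp a b := by
    rcases a with _ | _ <;> rcases b with _ | _ <;> rfl
  comp_id a b := by
    rcases a with _ | _ <;> rcases b with _ | _ <;> rfl
  assoc a b c d := by
    rcases a with _ | _ <;> rcases b with _ | _ <;> rcases c with _ | _ <;> rcases d with _ | _ <;>
      first
        | rfl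
        | (ext p; first | exact p.1.elim | exact p.2.1.elim)

/-- The continuous maps between spaces of morphisms given by `U f`. -/
def UMap {S T : CGWH.{u}} (f : S ⟶ T) : ∀ a b : TwoObj.{u}, TwoObj.Hom S a b ⟶ TwoObj.Hom T a b
  | .x, .x => 𝟙 _
  | .x, .y => f
  | .y, .x => 𝟙 _
  | .y, .y => 𝟙 _

/-- The functor `U` from spaces to topological categories: `U S` has two objects `x` and `y`, the
space of morphisms from `x` to `y` is `S`, and all other morphisms are identities. -/
def U : CGWH.{u} ⥤ CatTop.{u} where
  obj S := of (UObj S)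
  map {S T} f :=
    { obj := fun a ↦ a
      map := UMap f
      map_id := by
        rintro (_ | _) <;> rfl
      map_comp := by
        rintro (_ | _) (_ | _) (_ | _) <;> rfl }
  map_id S := EnrichedFunctor.ext _ (fun _ ↦ rfl) (by rintro (_ | _) (_ | _) <;> rfl)
  map_comp f g := EnrichedFunctor.ext _ (fun _ ↦ rfl) (by rintro (_ | _) (_ | _) <;> rfl)

end CatTop

section WeakEquivalence

variable {X Y : Type*} [TopologicalSpace X] [TopologicalSpace Y]

/-- The map induced by a continuous map on sets of path components. -/
def ContinuousMap.mapZerothHomotopy (f : C(X, Y)) : ZerothHomotopy X → ZerothHomotopy Y :=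
  ZerothHomotopy.lift (fun x ↦ .mk (f x)) fun _ _ p ↦ ZerothHomotopy.sound (p.map f.continuous)

/-- The map induced by a continuous map on `n`-dimensional loops. -/
def ContinuousMap.mapGenLoop (f : C(X, Y)) (n : ℕ) (x : X) (p : GenLoop (Fin n) X x) :
    GenLoop (Fin n) Y (f x) :=
  ⟨f.comp p.1, fun t ht ↦ congr_arg f (p.2 t ht)⟩

/-- The map induced by a continuous map on homotopy groups. -/
def ContinuousMap.mapHomotopyGroup (f : C(X, Y)) (n : ℕ) (x : X) :
    HomotopyGroup (Fin n) X x → HomotopyGroup (Fin n) Y (f x) :=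
  Quotient.map (f.mapGenLoop n x) fun _ _ h ↦ h.comp_continuousMap f

/-- A continuous map is a *weak homotopy equivalence* if it induces a bijection on path components
and on all homotopy groups, for all base points. -/
def ContinuousMap.IsWeakHomotopyEquiv (f : C(X, Y)) : Prop :=
  Function.Bijective f.mapZerothHomotopy ∧
    ∀ n : ℕ, 1 ≤ n → ∀ x : X, Function.Bijective (f.mapHomotopyGroup n x)

end WeakEquivalence

end

open scoped unitInterval

noncomputable section

/-! The horn inclusion is the inclusion of a strong deformation retract, and this structure passes
through `U` and through the pushout, so no explicit description of the morphism spaces of `D` is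
needed.

To speak of homotopies inside `CatTop`, each `C` gets a category `path C` with the same objects and
with the path spaces of its morphism spaces. A functor `D ⟶ path D` followed by `eval D t` is then a
homotopy of functors that is constant on objects. A deformation of the simplex becomes a functor
`UPath H` on `U` of the simplex. The universal property of the pushout extends the retraction to `R
: D ⟶ C` (glued with the identity of `C`) and the deformation to `Φ : D ⟶ path D` (glued with
constant paths on `C`).

On morphism spaces, `R` and `Φ` make `F` a strong deformation retract inclusion
(`bijective_and_isEmbedding_of_retract`). The left inverse gives the embedding and the deformation
gives the weak equivalence. -/

/-! ### Weak Hausdorffness of path spaces. -/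

theorem WeaklyHausdorffSpace.of_injective {X Y : Type u} [TopologicalSpace X] [TopologicalSpace Y]
    [WeaklyHausdorffSpace Y] (f : C(X, Y)) (hf : Function.Injective f) :
    WeaklyHausdorffSpace X where
  isClosed_range K g := by
    have h := (isClosed_range K (f.comp g)).preimage f.continuous
    rwa [ContinuousMap.coe_comp, Set.range_comp, Set.preimage_image_eq _ hf] at h

/-- The image of `K` lies in the product of its coordinate projections. Each of these is closed and
Hausdorff, so their product is a closed Hausdorff subspace, in which a compact image is closed. -/
instance {ι : Type u} (X : ι → Type u) [∀ i, TopologicalSpace (X i)]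
    [∀ i, WeaklyHausdorffSpace (X i)] : WeaklyHausdorffSpace (∀ i, X i) where
  isClosed_range K f := by
    let p (i : ι) : C(K, X i) := (ContinuousMap.eval i).comp f
    have (i : ι) := WeaklyHausdorffSpace.t2_range K (p i)
    let e : (∀ i, Set.range (p i)) → ∀ i, X i := fun x i ↦ (x i).1
    have he : IsClosedEmbedding e := by
      refine ⟨.piMap fun i ↦ IsEmbedding.subtypeVal, ?_⟩
      have h : Set.range e = Set.univ.pi fun i ↦ Set.range (p i) := by
        ext x
        simp only [Set.mem_range, Set.mem_univ_pi]
        exact ⟨by rintro ⟨y, rfl⟩ i; exact (y i).2, fun hx ↦ ⟨fun i ↦ ⟨x i, hx i⟩, rfl⟩⟩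
      rw [h]
      exact isClosed_set_pi fun i _ ↦ WeaklyHausdorffSpace.isClosed_range K (p i)
    let g : K → ∀ i, Set.range (p i) := fun k i ↦ ⟨p i k, k, rfl⟩
    have hg : Continuous g := by fun_prop
    have h := he.isClosedMap _ (isCompact_range hg).isClosed
    rwa [← Set.range_comp] at h

instance (X : Type u) [TopologicalSpace X] [WeaklyHausdorffSpace X] :
    WeaklyHausdorffSpace C(I, X) :=
  -- A path is determined by its values. `ULift` puts the index set in the universe of `X`.
  .of_injective (Y := ULift.{u} I → X)
    ⟨fun f t ↦ f t.down, by fun_prop⟩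
    fun f g h ↦ ContinuousMap.ext fun t ↦ congr_fun h ⟨t⟩

/-! ### Path spaces in `CGWH` and their compatibility with products. -/

namespace CGWH

/-- The space of paths in a space, with the compactly generated topology associated to the
compact-open topology. -/
abbrev pathSpace (X : CGWH.{u}) : CGWH.{u} :=
  of (WithGeneratedByTopology compHausFamily.{u} C(I, X))

/-- A path in a space, as a point of its space of paths. -/
abbrev toPathSpace {X : CGWH.{u}} (γ : C(I, X)) : pathSpace X :=
  (WithGeneratedByTopology.equiv (X := compHausFamily.{u})).symm γ

/-- The path underlying a point of a space of paths. -/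
abbrev ofPathSpace {X : CGWH.{u}} (γ : pathSpace X) : C(I, X) :=
  WithGeneratedByTopology.equiv (X := compHausFamily.{u}) γ

/-- A pair of points, as a point of the product. -/
abbrev pair {X Y : CGWH.{u}} (x : X) (y : Y) : prod X Y :=
  (WithGeneratedByTopology.equiv (X := compHausFamily.{u})).symm (x, y)

theorem continuous_toPathSpace {X Y : CGWH.{u}} {f : X → C(I, Y)} (hf : Continuous f) :
    Continuous fun x ↦ toPathSpace (f x) :=
  (IsGeneratedBy.equiv_symm_comp_continuous_iff _ f).2 hf

/-- A homotopy, as a morphism to the space of paths. -/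
def curryPath {X Y : CGWH.{u}} (H : C(X × I, Y)) : X ⟶ pathSpace Y :=
  ofHom ⟨_, continuous_toPathSpace H.curry.continuous⟩

/-- The constant paths. -/
def constPath (X : CGWH.{u}) : X ⟶ pathSpace X :=
  curryPath ContinuousMap.fst

/-- Evaluation of paths at a point of the unit interval. -/
def evalPath (X : CGWH.{u}) (t : I) : pathSpace X ⟶ X :=
  ofHom ⟨fun γ ↦ ofPathSpace γ t,
    (continuous_eval_const t).comp WithGeneratedByTopology.continuous_equiv⟩

/-- The action of a continuous map on paths. -/
def mapPath {X Y : CGWH.{u}} (f : X ⟶ Y) : pathSpace X ⟶ pathSpace Y :=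
  ofHom ⟨fun γ ↦ toPathSpace ((toMap f).comp (ofPathSpace γ)),
    continuous_toPathSpace
      ((ContinuousMap.continuous_postcomp _).comp WithGeneratedByTopology.continuous_equiv)⟩

theorem compactlyGeneratedSpace_of_compactSpace (K : Type u) [TopologicalSpace K] [CompactSpace K]
    [T2Space K] : CompactlyGeneratedSpace K :=
  uCompactlyGeneratedSpace_of_isClosed fun _ hs ↦ hs (CompHaus.of K) (.id K)

/-- The topology of `prod` may be finer than the product topology, so continuity into it is tested
on a compactly generated source. Here `K × I` is compact Hausdorff. -/
theorem continuous_pair_path {K : CompHaus.{u}} {X Y : CGWH.{u}} {f : K → C(I, X)}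
    {g : K → C(I, Y)} (hf : Continuous f) (hg : Continuous g) :
    Continuous fun p : K × I ↦ pair (f p.1 p.2) (g p.1 p.2) :=
  have : CompactlyGeneratedSpace (K × I) := compactlyGeneratedSpace_of_compactSpace _
  continuous_prodMk (X := of (K × I)) (f := fun p ↦ f p.1 p.2) (g := fun p ↦ g p.1 p.2)
    (by fun_prop) (by fun_prop)

/-- The path of pairs given by a pair of paths. -/
def pairPath {X Y : CGWH.{u}} (γ : C(I, X)) (δ : C(I, Y)) : C(I, prod X Y) where
  toFun t := pair (γ t) (δ t)
  -- The one-point `K` replaces `I` by the homeomorphic `PUnit × I`, which lives in universe `u`.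
  continuous_toFun := (continuous_pair_path (K := CompHaus.of PUnit.{u + 1}) (f := fun _ ↦ γ)
    (g := fun _ ↦ δ) continuous_const continuous_const).comp (Continuous.prodMk_right PUnit.unit)

/-- The product of spaces of paths maps to the space of paths in the product. -/
def pathPair (X Y : CGWH.{u}) : prod (pathSpace X) (pathSpace Y) ⟶ pathSpace (prod X Y) :=
  let fst (p : prod (pathSpace X) (pathSpace Y)) : C(I, X) := ofPathSpace (prodFst _ _ p)
  let snd (p : prod (pathSpace X) (pathSpace Y)) : C(I, Y) := ofPathSpace (prodSnd _ _ p)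
  have hfst : Continuous fst :=
    WithGeneratedByTopology.continuous_equiv.comp (toMap (prodFst _ _)).continuous
  have hsnd : Continuous snd :=
    WithGeneratedByTopology.continuous_equiv.comp (toMap (prodSnd _ _)).continuous
  ofHom ⟨fun p ↦ toPathSpace (pairPath (fst p) (snd p)),
    -- Testing on compact Hausdorff `K` reduces the claim, by currying, to continuity on `K × I`.
    continuous_from_uCompactlyGeneratedSpace _ fun K g ↦
      have : CompactlyGeneratedSpace K := compactlyGeneratedSpace_of_compactSpace _
      continuous_toPathSpace (X := of K) (f := fun k ↦ pairPath (fst (g k)) (snd (g k)))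
        (ContinuousMap.continuous_of_continuous_uncurry _
          (continuous_pair_path (hfst.comp g.continuous) (hsnd.comp g.continuous)))⟩

end CGWH

/-! ### The topological category of paths. -/

namespace CatTop

open CGWH

theorem id_comp_apply (C : CatTop.{u}) {a b : C} (f : C.Map a b) :
    toMap (eComp CGWH.{u} a a b) (pair (toMap (eId CGWH.{u} a) PUnit.unit) f) = f :=
  congr_arg (fun g ↦ toMap g f) (EnrichedCategory.id_comp (V := CGWH.{u}) a b)

theorem comp_id_apply (C : CatTop.{u}) {a b : C} (f : C.Map a b) :
    toMap (eComp CGWH.{u} a b b) (pair f (toMap (eId CGWH.{u} b) PUnit.unit)) = f :=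
  congr_arg (fun g ↦ toMap g f) (EnrichedCategory.comp_id (V := CGWH.{u}) a b)

theorem assoc_apply (C : CatTop.{u}) {a b c d : C} (f : C.Map a b) (g : C.Map b c)
    (h : C.Map c d) :
    toMap (eComp CGWH.{u} a c d) (pair (toMap (eComp CGWH.{u} a b c) (pair f g)) h) =
      toMap (eComp CGWH.{u} a b d) (pair f (toMap (eComp CGWH.{u} b c d) (pair g h))) :=
  congr_arg (fun k ↦ toMap k (pair f (pair g h))) (EnrichedCategory.assoc (V := CGWH.{u}) a b c d)

theorem map_id_apply {C D : CatTop.{u}} (F : C ⟶ D) (a : C) :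
    map F a a (toMap (eId CGWH.{u} a) PUnit.unit) = toMap (eId CGWH.{u} (obj F a)) PUnit.unit :=
  congr_arg (fun k ↦ toMap k PUnit.unit) (EnrichedFunctor.map_id F a)

theorem map_comp_apply {C D : CatTop.{u}} (F : C ⟶ D) {a b c : C} (f : C.Map a b) (g : C.Map b c) :
    map F a c (toMap (eComp CGWH.{u} a b c) (pair f g)) =
      toMap (eComp CGWH.{u} (obj F a) (obj F b) (obj F c)) (pair (map F a b f) (map F b c g)) :=
  congr_arg (fun k ↦ toMap k (pair f g)) (EnrichedFunctor.map_comp F a b c)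

theorem hom_ext {X Y : CGWH.{u}} {f g : X ⟶ Y} (h : ∀ x, toMap f x = toMap g x) : f = g := by
  ext x
  exact h x

/-- The objects of the topological category of paths in `C`. -/
def PathObj (C : CatTop.{u}) : Type u := C

/-- Paths are composed pointwise, so the axioms are those of `C` at each time `t`. -/
instance (C : CatTop.{u}) : EnrichedCategory CGWH.{u} (PathObj C) where
  Hom a b := pathSpace (C.Map a b)
  id a := eId CGWH.{u} (C := C) a ≫ constPath _
  comp a b c := pathPair _ _ ≫ mapPath (eComp CGWH.{u} (C := C) a b c)
  id_comp _ _ := hom_ext fun γ ↦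
    ContinuousMap.ext (f := ofPathSpace _) fun t ↦ id_comp_apply C (ofPathSpace γ t)
  comp_id _ _ := hom_ext fun γ ↦
    ContinuousMap.ext (f := ofPathSpace _) fun t ↦ comp_id_apply C (ofPathSpace γ t)
  assoc _ _ _ _ := hom_ext fun γ ↦
    ContinuousMap.ext (f := ofPathSpace _) fun t ↦
      assoc_apply C (ofPathSpace γ.1 t) (ofPathSpace γ.2.1 t) (ofPathSpace γ.2.2 t)

/-- The topological category with the objects of `C` whose spaces of morphisms are the spaces of
paths in the spaces of morphisms of `C`. -/
def path (C : CatTop.{u}) : CatTop.{u} := of (PathObj C)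

/-- The functor from `C` to its category of paths given by the constant paths. -/
def const (C : CatTop.{u}) : C ⟶ path C where
  obj a := a
  map _ _ := constPath _
  map_id _ := rfl
  map_comp _ _ _ := rfl

/-- Evaluation of paths, as a functor. -/
def eval (C : CatTop.{u}) (t : I) : path C ⟶ C where
  obj a := a
  map _ _ := evalPath _ t
  map_id _ := rfl
  map_comp _ _ _ := rfl

/-- The functor between categories of paths induced by a functor. -/
def mapOfPath {C D : CatTop.{u}} (F : C ⟶ D) : path C ⟶ path D where
  obj := obj (C := C) (D := D) F
  map a b := mapPath (X := C.Map a b) (Y := D.Map (obj F a) (obj F b)) (EnrichedFunctor.map F a b)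
  map_id a := hom_ext (X := point) (Y := pathSpace (D.Map (obj F a) (obj F a))) fun _ ↦
    ContinuousMap.ext (f := ofPathSpace _) fun _ ↦ map_id_apply F a
  map_comp a b c := hom_ext (X := CGWH.prod (pathSpace (C.Map a b)) (pathSpace (C.Map b c)))
    (Y := pathSpace (D.Map (obj F a) (obj F c))) fun γ ↦
    ContinuousMap.ext (f := ofPathSpace _) fun t ↦
      map_comp_apply F (ofPathSpace γ.1 t) (ofPathSpace γ.2 t)

theorem const_eval (C : CatTop.{u}) (t : I) : const C ≫ eval C t = 𝟙 C := rfl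

theorem const_mapOfPath {C D : CatTop.{u}} (F : C ⟶ D) : const C ≫ mapOfPath F = F ≫ const D :=
  rfl

theorem mapOfPath_eval {C D : CatTop.{u}} (F : C ⟶ D) (t : I) :
    mapOfPath F ≫ eval D t = eval C t ≫ F :=
  rfl

/-- The map `UMap` for a homotopy. -/
def UPathMap {S T : CGWH.{u}} (H : S ⟶ pathSpace T) :
    ∀ a b : TwoObj.{u}, TwoObj.Hom S a b ⟶ pathSpace (TwoObj.Hom T a b)
  | .x, .x => constPath _
  | .x, .y => H
  | .y, .x => constPath _
  | .y, .y => constPath _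

/-- The functor from `U S` to the category of paths in `U T` given by a homotopy. -/
def UPath {S T : CGWH.{u}} (H : S ⟶ pathSpace T) : U.obj S ⟶ path (U.obj T) where
  obj a := a
  map := UPathMap H
  map_id := by rintro (_ | _) <;> rfl
  map_comp := by
    rintro (_ | _) (_ | _) (_ | _) <;> rfl

/-- This identifies the two ends of the deformation of `U T`. The next two lemmas express that a
homotopy stationary on `R` becomes constant on `U R`, which is the gluing condition over the horn.
-/
theorem UPath_eval {S T : CGWH.{u}} (H : S ⟶ pathSpace T) (t : I) :
    UPath H ≫ eval _ t = U.map (H ≫ evalPath T t) :=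
  EnrichedFunctor.ext _ (fun _ ↦ rfl) (by rintro (_ | _) (_ | _) <;> rfl)

theorem U_map_UPath {R S T : CGWH.{u}} (f : R ⟶ S) (H : S ⟶ pathSpace T) :
    U.map f ≫ UPath H = UPath (f ≫ H) :=
  EnrichedFunctor.ext _ (fun _ ↦ rfl) (by rintro (_ | _) (_ | _) <;> rfl)

theorem UPath_constPath {S T : CGWH.{u}} (f : S ⟶ T) :
    UPath (f ≫ constPath T) = U.map f ≫ const _ :=
  EnrichedFunctor.ext _ (fun _ ↦ rfl) (by rintro (_ | _) (_ | _) <;> rfl)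

end CatTop

/-! ### Deformation of the simplex into the horn, in barycentric coordinates. -/

namespace HornRealization

open Simplicial

variable {n : ℕ} (i : Fin (n + 2))

/-- The least of the barycentric coordinates of a point other than the `i`-th. -/
def minCoord (s : stdSimplex ℝ (Fin (n + 2))) : ℝ :=
  Finset.univ.inf' Finset.univ_nonempty fun l ↦ s (i.succAbove l)

theorem continuous_minCoord : Continuous (minCoord i) := by
  unfold minCoord
  refine Continuous.finset_inf'_apply _ fun l _ ↦ ?_
  exact (continuous_apply _).comp continuous_subtype_val

theorem minCoord_nonneg (s : stdSimplex ℝ (Fin (n + 2))) : 0 ≤ minCoord i s :=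
  Finset.le_inf' _ _ fun _ _ ↦ stdSimplex.zero_le s _

theorem minCoord_le (s : stdSimplex ℝ (Fin (n + 2))) (l : Fin (n + 1)) :
    minCoord i s ≤ s (i.succAbove l) :=
  Finset.inf'_le _ (Finset.mem_univ l)

theorem exists_minCoord_eq (s : stdSimplex ℝ (Fin (n + 2))) :
    ∃ l, minCoord i s = s (i.succAbove l) := by
  obtain ⟨l, -, hl⟩ := Finset.exists_mem_eq_inf' Finset.univ_nonempty fun l ↦ s (i.succAbove l)
  exact ⟨l, hl⟩

theorem minCoord_eq_zero {s : stdSimplex ℝ (Fin (n + 2))} {j : Fin (n + 2)} (hj : j ≠ i)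
    (h : s j = 0) : minCoord i s = 0 := by
  obtain ⟨l, rfl⟩ := Fin.exists_succAbove_eq hj
  exact le_antisymm (h ▸ minCoord_le i s l) (minCoord_nonneg i s)

/-- The barycentric coordinates of `push`. -/
def pushCoord (s : stdSimplex ℝ (Fin (n + 2))) (t : I) : Fin (n + 2) → ℝ :=
  -- Each of the `n + 1` other coordinates loses `t * minCoord i s`. The `i`-th gains their total,
  -- so the sum stays `1`.
  i.insertNth (s i + t * ((n + 1) * minCoord i s)) fun l ↦ s (i.succAbove l) - t * minCoord i s

@[simp]
theorem pushCoord_self (s : stdSimplex ℝ (Fin (n + 2))) (t : I) :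
    pushCoord i s t i = s i + t * ((n + 1) * minCoord i s) := by
  rw [pushCoord, Fin.insertNth_apply_same]

@[simp]
theorem pushCoord_succAbove (s : stdSimplex ℝ (Fin (n + 2))) (t : I) (l : Fin (n + 1)) :
    pushCoord i s t (i.succAbove l) = s (i.succAbove l) - t * minCoord i s := by
  rw [pushCoord, Fin.insertNth_apply_succAbove]

theorem pushCoord_mem (s : stdSimplex ℝ (Fin (n + 2))) (t : I) :
    pushCoord i s t ∈ stdSimplex ℝ (Fin (n + 2)) := by
  refine ⟨fun j ↦ ?_, ?_⟩
  · obtain hji | ⟨l, rfl⟩ := Fin.eq_self_or_eq_succAbove i j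
    · rw [hji, pushCoord_self]
      have h₁ := stdSimplex.zero_le s i
      have h₂ := minCoord_nonneg i s
      have h₃ := t.2.1
      positivity
    · rw [pushCoord_succAbove, sub_nonneg]
      exact (mul_le_of_le_one_left (minCoord_nonneg i s) t.2.2).trans (minCoord_le i s l)
  · have hsum := stdSimplex.sum_eq_one s
    rw [Fin.sum_univ_succAbove _ i] at hsum ⊢
    simp only [pushCoord_self, pushCoord_succAbove, Finset.sum_sub_distrib,
      Finset.sum_const, Finset.card_univ, Fintype.card_fin, nsmul_eq_mul]
    push_cast
    linarith

/-- The motion of the points of the simplex, along the line through the barycenter of the `i`-th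
face and the `i`-th vertex, towards the horn opposite to that face. -/
def push (s : stdSimplex ℝ (Fin (n + 2))) (t : I) : stdSimplex ℝ (Fin (n + 2)) :=
  ⟨pushCoord i s t, pushCoord_mem i s t⟩

theorem push_apply (s : stdSimplex ℝ (Fin (n + 2))) (t : I) (j : Fin (n + 2)) :
    push i s t j = pushCoord i s t j :=
  rfl

theorem continuous_push :
    Continuous fun p : stdSimplex ℝ (Fin (n + 2)) × I ↦ push i p.1 p.2 := by
  have h₁ := (continuous_minCoord i).comp
    (continuous_fst (X := stdSimplex ℝ (Fin (n + 2))) (Y := I))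
  have h₂ (j) : Continuous fun p : stdSimplex ℝ (Fin (n + 2)) × I ↦ p.1 j :=
    (continuous_apply j).comp (continuous_subtype_val.comp continuous_fst)
  refine Continuous.subtype_mk (continuous_pi fun j ↦ ?_) _
  obtain hji | ⟨l, rfl⟩ := Fin.eq_self_or_eq_succAbove i j
  · simp only [hji, pushCoord_self]
    exact (h₂ _).add ((continuous_subtype_val.comp continuous_snd).mul (continuous_const.mul h₁))
  · simp only [pushCoord_succAbove]
    exact (h₂ _).sub ((continuous_subtype_val.comp continuous_snd).mul h₁)

/-- Covers both stationary cases: time `0`, and points of the horn, where `minCoord` vanishes. -/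
theorem push_eq_self {s : stdSimplex ℝ (Fin (n + 2))} {t : I} (h : t * minCoord i s = 0) :
    push i s t = s := by
  ext j
  obtain hji | ⟨l, rfl⟩ := Fin.eq_self_or_eq_succAbove i j
  · rw [hji, push_apply, pushCoord_self]
    linear_combination (n + 1 : ℝ) * h
  · rw [push_apply, pushCoord_succAbove, h, sub_zero]

/-- At time `1` the coordinate attaining the minimum has lost its whole value. -/
theorem exists_push_one_apply_eq_zero (s : stdSimplex ℝ (Fin (n + 2))) :
    ∃ j, j ≠ i ∧ push i s 1 j = 0 := by
  obtain ⟨l, hl⟩ := exists_minCoord_eq i s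
  exact ⟨_, Fin.succAbove_ne i l, by simp [push_apply, hl]⟩

theorem toTop_map_ι_ι (j : Fin (n + 2)) (hj : j ≠ i) (x : |(Δ[n] : SSet.{u})|) :
    SSet.toTop.map Λ[n + 1, i].ι (SSet.toTop.map (SSet.horn.ι i j hj) x) =
      SSet.toTop.map (SSet.stdSimplex.δ j) x := by
  rw [← SSet.horn.ι_ι i j hj, Functor.map_comp]
  rfl

/-- The points of the realization of a horn are those with a vanishing barycentric coordinate
other than the `i`-th. -/
theorem mem_range_toTop_map_ι_iff (x : |(Δ[n + 1] : SSet.{u})|) :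
    x ∈ Set.range (SSet.toTop.map (Λ[n + 1, i] : (Δ[n + 1] : SSet.{u}).Subcomplex).ι) ↔
      ∃ j, j ≠ i ∧ SimplexCategory.toTopHomeo ⦋n + 1⦌ x j = 0 := by
  constructor
  · rintro ⟨p, rfl⟩
    obtain ⟨j, hj, y, rfl⟩ := exists_face n i p
    exact ⟨j, hj, by rw [toTop_map_ι_ι, toTopHomeo_δ, map_succAbove_self]⟩
  · rintro ⟨j, hj, h⟩
    obtain ⟨c, hc⟩ := exists_of_apply_eq_zero j _ h
    obtain ⟨y, rfl⟩ := (SimplexCategory.toTopHomeo ⦋n⦌).surjective c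
    refine ⟨SSet.toTop.map (SSet.horn.ι i j hj) y, ?_⟩
    rw [toTop_map_ι_ι]
    exact (SimplexCategory.toTopHomeo ⦋n + 1⦌).injective ((toTopHomeo_δ j y).trans hc)

end HornRealization

/-! ### The horn as a strong deformation retract of the simplex. -/

section

open Simplicial HornRealization

variable (n : ℕ) (i : Fin (n + 2))

/-- The deformation of the simplex into the horn. -/
def hornHomotopy : C(simplexSpace.{u} (n + 1) × I, simplexSpace.{u} (n + 1)) where
  toFun p := (SimplexCategory.toTopHomeo ⦋n + 1⦌).symm
    (push i (SimplexCategory.toTopHomeo ⦋n + 1⦌ p.1) p.2)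
  continuous_toFun := (SimplexCategory.toTopHomeo ⦋n + 1⦌).symm.continuous.comp
    ((continuous_push i).comp (.prodMap (SimplexCategory.toTopHomeo ⦋n + 1⦌).continuous
      continuous_id))

theorem hornHomotopy_zero (x : simplexSpace.{u} (n + 1)) : hornHomotopy n i (x, 0) = x :=
  (SimplexCategory.toTopHomeo ⦋n + 1⦌).symm_apply_eq.2 (push_eq_self i (zero_mul _))

theorem hornHomotopy_hornInclusion (p : hornSpace.{u} n i) (t : I) :
    hornHomotopy n i (CGWH.toMap (hornInclusion n i) p, t) = CGWH.toMap (hornInclusion n i) p := by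
  obtain ⟨j, hj, h⟩ := (mem_range_toTop_map_ι_iff i _).1 ⟨p, rfl⟩
  exact (SimplexCategory.toTopHomeo ⦋n + 1⦌).symm_apply_eq.2
    (push_eq_self i (mul_eq_zero_of_right _ (minCoord_eq_zero i hj h)))

theorem hornHomotopy_one_mem (x : simplexSpace.{u} (n + 1)) :
    hornHomotopy n i (x, 1) ∈ Set.range (CGWH.toMap (hornInclusion.{u} n i)) :=
  (mem_range_toTop_map_ι_iff i _).2 <| by
    simpa [hornHomotopy] using exists_push_one_apply_eq_zero i _

theorem isClosedEmbedding_hornInclusion :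
    IsClosedEmbedding (CGWH.toMap (hornInclusion.{u} n i)) :=
  (CGWH.toMap (hornInclusion n i)).continuous.isClosedEmbedding (toTop_map_ι_injective n i)

/-- The horn is a retract of the simplex, by the end of the deformation. -/
theorem exists_hornRetraction : ∃ r : simplexSpace.{u} (n + 1) ⟶ hornSpace.{u} n i,
    hornInclusion n i ≫ r = 𝟙 _ ∧
      ∀ x, CGWH.toMap (r ≫ hornInclusion n i) x = hornHomotopy n i (x, 1) := by
  choose r hr using hornHomotopy_one_mem.{u} n i
  have hc : Continuous r := by
    -- The retraction is chosen pointwise. It is continuous because its composite with the embedding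
    -- of the horn is the deformation at time `1`.
    rw [(isClosedEmbedding_hornInclusion n i).isInducing.continuous_iff]
    exact ((hornHomotopy n i).continuous.comp (.prodMk_left 1)).congr fun x ↦ (hr x).symm
  refine ⟨CGWH.ofHom ⟨r, hc⟩, CatTop.hom_ext fun p ↦ ?_, hr⟩
  apply (isClosedEmbedding_hornInclusion n i).injective
  exact (hr _).trans (hornHomotopy_hornInclusion n i p 1)

end

/-! ### Strong deformation retracts and weak homotopy equivalences. -/

section

variable {X Y : Type*} [TopologicalSpace X] [TopologicalSpace Y]

/-- The inclusion of a strong deformation retract is a weak homotopy equivalence. -/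
theorem ContinuousMap.IsWeakHomotopyEquiv.of_deformationRetract (f : C(X, Y)) (r : C(Y, X))
    (H : C(Y × I, Y)) (hr : ∀ x, r (f x) = x) (h₀ : ∀ y, H (y, 0) = y)
    (h₁ : ∀ y, H (y, 1) = f (r y)) (hf : ∀ x t, H (f x, t) = f x) : f.IsWeakHomotopyEquiv := by
  have hpath (y : Y) : Joined (f (r y)) y :=
    Joined.symm ⟨⟨⟨fun t ↦ H (y, t), by fun_prop⟩, h₀ y, h₁ y⟩⟩
  refine ⟨⟨?_, ?_⟩, fun n _ x ↦ ⟨?_, ?_⟩⟩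
  · rintro ⟨a⟩ ⟨b⟩ hab
    obtain ⟨p⟩ := Quotient.exact hab
    exact Quotient.sound ⟨(p.map r.continuous).cast (hr a).symm (hr b).symm⟩
  · rintro ⟨b⟩
    exact ⟨Quotient.mk _ (r b), Quotient.sound (hpath b)⟩
  · rintro ⟨p⟩ ⟨q⟩ hpq
    have h := (Quotient.exact hpq : GenLoop.Homotopic _ _).comp_continuousMap r
    apply Quotient.sound
    -- `r (f x)` equals `x` only propositionally, so the based loops are compared through their
    -- underlying maps.
    change ContinuousMap.HomotopicRel p.1 q.1 _
    convert h using 1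
    · ext t; exact (hr _).symm
    · ext t; exact (hr _).symm
  · rintro ⟨q⟩
    refine ⟨Quotient.mk _ ⟨r.comp q.1, fun t ht ↦ ?_⟩, Quotient.sound ?_⟩
    · exact (congr_arg r (q.2 t ht)).trans (hr x)
    -- Applying `H` to `q` moves `q` to `f ∘ r ∘ q`. The boundary stays put because `q` sends it to
    -- `f x`, which `H` fixes.
    · refine ContinuousMap.HomotopicRel.symm ⟨⟨⟨⟨fun p ↦ H (q.1 p.2, p.1), by fun_prop⟩,
        fun t ↦ h₀ _, fun t ↦ h₁ _⟩, fun t s hs ↦ ?_⟩⟩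
      have hq : q.1 s = f x := q.2 s hs
      exact (congr_arg (fun y ↦ H (y, t)) hq).trans ((hf x t).trans hq.symm)

end

/-! ### From a deformation of functors to the morphism spaces. -/

namespace CatTop

open CGWH

/-- Equal functors have object values that agree only propositionally, so their values on morphisms
lie in different types. Heterogeneous equality and `castMap` bridge the gap. -/
theorem heq_map_of_eq {C D : CatTop.{u}} {F G : C ⟶ D} (h : F = G) {a b : C} (f : C.Map a b) :
    HEq (map F a b f) (map G a b f) := by
  rw [h]

/-- The identification of spaces of morphisms between equal objects. -/
def castMap (C : CatTop.{u}) {a b a' b' : C} (ha : a = a') (hb : b = b') :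
    C(C.Map a b, C.Map a' b') := by
  subst ha hb
  exact .id _

theorem castMap_heq (C : CatTop.{u}) {a b a' b' : C} (ha : a = a') (hb : b = b') (f : C.Map a b) :
    HEq (castMap C ha hb f) f := by
  subst ha hb
  rfl

theorem map_castMap {C D : CatTop.{u}} (F : C ⟶ D) {a b a' b' : C} (ha : a = a') (hb : b = b')
    (f : C.Map a b) : HEq (map F a' b' (castMap C ha hb f)) (map F a b f) := by
  subst ha hb
  rfl

/-- A functor of topological categories which is a strong deformation retract, with a deformation
fixing objects, is bijective on objects, and given by embeddings and weak homotopy equivalences on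
spaces of morphisms. -/
theorem bijective_and_isEmbedding_of_retract {C D : CatTop.{u}} (F : C ⟶ D) (R : D ⟶ C)
    (Φ : D ⟶ path D) (hR : F ≫ R = 𝟙 C) (h₀ : Φ ≫ eval D 0 = 𝟙 D) (h₁ : Φ ≫ eval D 1 = R ≫ F)
    (hF : F ≫ Φ = F ≫ const D) :
    Function.Bijective (obj F) ∧
      ∀ w z : C, IsEmbedding (map F w z) ∧ (map F w z).IsWeakHomotopyEquiv := by
  have hobj (w : C) : obj R (obj F w) = w := congr_arg (fun G ↦ obj G w) hR
  -- `path D` has the objects of `D`, so `Φ` acts on objects as a self-map of `D`; evaluation at `0`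
  -- shows that it is the identity.
  let φ : D → D := obj (C := D) (D := path D) Φ
  have hobj₀ (d : D) : φ d = d := congr_arg (fun G ↦ obj G d) h₀
  have hobj₁ (d : D) : obj F (obj R d) = d :=
    (congr_arg (fun G ↦ obj G d) h₁).symm.trans (hobj₀ d)
  refine ⟨⟨Function.LeftInverse.injective hobj, fun d ↦ ⟨_, hobj₁ d⟩⟩, fun w z ↦ ?_⟩
  let r : C(D.Map (obj F w) (obj F z), C.Map w z) :=
    (castMap C (hobj w) (hobj z)).comp (map R _ _)
  have hr (f : C.Map w z) : r (map F w z f) = f :=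
    eq_of_heq ((castMap_heq C _ _ _).trans (heq_map_of_eq hR f))
  let e : C(D.Map (obj F w) (obj F z), C(I, D.Map (φ (obj F w)) (φ (obj F z)))) :=
    ⟨fun g ↦ ofPathSpace (map Φ _ _ g),
      WithGeneratedByTopology.continuous_equiv.comp (map Φ _ _).continuous⟩
  -- `H` is the uncurried action of `Φ` on morphisms, transported along `φ d = d`.
  let H : C(D.Map (obj F w) (obj F z) × I, D.Map (obj F w) (obj F z)) :=
    (castMap D (hobj₀ _) (hobj₀ _)).comp ⟨fun p ↦ e p.1 p.2, by fun_prop⟩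
  have hH (g : D.Map (obj F w) (obj F z)) (t : I) :
      HEq (H (g, t)) (map (Φ ≫ eval D t) _ _ g) := castMap_heq D _ _ _
  refine ⟨.of_leftInverse hr r.continuous (map F w z).continuous,
    .of_deformationRetract _ r H hr (fun g ↦ ?_) (fun g ↦ ?_) fun f t ↦ ?_⟩
  · exact eq_of_heq ((hH g 0).trans (heq_map_of_eq h₀ g))
  · exact eq_of_heq ((hH g 1).trans ((heq_map_of_eq h₁ g).trans (map_castMap F _ _ _).symm))
  · refine eq_of_heq ((hH _ t).trans ?_)
    exact heq_map_of_eq (congr_arg (· ≫ eval D t) hF) f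

end CatTop

end

/-! ### Gluing the retraction and the deformation over the pushout. -/

theorem mainTheorem4 (n : ℕ) (i : Fin (n + 2)) {C D : CatTop.{u}}
    (h : CatTop.U.obj (hornSpace.{u} n i) ⟶ C) (k : CatTop.U.obj (simplexSpace.{u} (n + 1)) ⟶ D)
    (F : C ⟶ D) (sq : IsPushout h (CatTop.U.map (hornInclusion n i)) F k) :
    Function.Bijective (CatTop.obj F) ∧
      ∀ w z : C, IsEmbedding (CatTop.map F w z) ∧ (CatTop.map F w z).IsWeakHomotopyEquiv := by
  obtain ⟨r, hr, hr₁⟩ := exists_hornRetraction.{u} n i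
  let H := CGWH.curryPath (hornHomotopy.{u} n i)
  have hH : hornInclusion n i ≫ H = hornInclusion n i ≫ CGWH.constPath _ :=
    CatTop.hom_ext fun p ↦ ContinuousMap.ext (f := CGWH.ofPathSpace _) fun t ↦
      hornHomotopy_hornInclusion n i p t
  have hH₀ : H ≫ CGWH.evalPath _ 0 = 𝟙 _ := CatTop.hom_ext fun x ↦ hornHomotopy_zero n i x
  have hH₁ : H ≫ CGWH.evalPath _ 1 = r ≫ hornInclusion n i :=
    CatTop.hom_ext fun x ↦ (hr₁ x).symm
  -- The two legs agree over the horn because `r` retracts the simplex onto it.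
  let R : D ⟶ C := sq.desc (𝟙 C) (CatTop.U.map r ≫ h) (by
    rw [← Category.assoc, ← Functor.map_comp, hr, CategoryTheory.Functor.map_id, Category.id_comp,
      Category.comp_id])
  -- The legs agree over the horn because `H` is stationary there, so both give constant paths.
  let Φ : D ⟶ CatTop.path D :=
    sq.desc (F ≫ CatTop.const D) (CatTop.UPath H ≫ CatTop.mapOfPath k) (by
      rw [← Category.assoc, ← Category.assoc, CatTop.U_map_UPath, hH, CatTop.UPath_constPath,
        Category.assoc (CatTop.U.map _), CatTop.const_mapOfPath, ← Category.assoc, sq.w])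
  have hFR : F ≫ R = 𝟙 C := sq.inl_desc _ _ _
  have hkR : k ≫ R = CatTop.U.map r ≫ h := sq.inr_desc _ _ _
  have hFΦ : F ≫ Φ = F ≫ CatTop.const D := sq.inl_desc _ _ _
  have hkΦ : k ≫ Φ = CatTop.UPath H ≫ CatTop.mapOfPath k := sq.inr_desc _ _ _
  have hF (t : unitInterval) : F ≫ Φ ≫ CatTop.eval D t = F := by
    rw [← Category.assoc, hFΦ, Category.assoc, CatTop.const_eval, Category.comp_id]
  have hk (t : unitInterval) :
      k ≫ Φ ≫ CatTop.eval D t = CatTop.U.map (H ≫ CGWH.evalPath _ t) ≫ k := by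
    rw [← Category.assoc, hkΦ, Category.assoc, CatTop.mapOfPath_eval, ← Category.assoc,
      CatTop.UPath_eval]
  -- The ends of `Φ` are functors out of a pushout, so they are identified on `C` and on `U` of the
  -- simplex separately.
  refine CatTop.bijective_and_isEmbedding_of_retract F R Φ hFR (sq.hom_ext ?_ ?_)
    (sq.hom_ext ?_ ?_) hFΦ
  · rw [hF, Category.comp_id]
  · rw [hk, hH₀, CategoryTheory.Functor.map_id, Category.id_comp, Category.comp_id]
  · rw [hF, ← Category.assoc, hFR, Category.id_comp]
  · rw [hk, hH₁, ← Category.assoc, hkR, Functor.map_comp, Category.assoc, Category.assoc, sq.w]
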